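/- All functions are complex-valued and all spaces are taken with respect to Lebesgue measure. For a bounded operator $T$ on $L_2(\mathbb R)$ let $\mu(n,T)=\inf\{\|T-R\| : \operatorname{rank}(R)\le n\}$ for $n\ge 0$ (operator norm), and for $p>0$ let $\|T\|_p=\left(\sum_{n=0}^\infty \mu(n,T)^p\right)^{1/p}\in[0,\infty]$. For $\phi\in L_2(\mathbb R^2)$ let $\operatorname{Op}(\phi)$ be the integral operator on $L_2(\mathbb R)$ given by $(\operatorname{Op}(\phi)f)(y)=\int_{\mathbb R}\phi(x,y)f(x)\,dx$. For $k\in L_\infty(\mathbb R^2)$ define the Schur multiplier quasi-norm $$\|k\|_{\mathfrak M_p}=\sup\left\{\|\operatorname{Op}(k\phi)\|_p : \phi\in L_2(\mathbb R^2),\ \|\operatorname{Op}(\phi)\|_p\le 1\right\}\in[0,\infty].$$ **Theorem.** Let $k\in L_\infty(\mathbb R^2)$, let $0<p\le 1$, and put $p^\flat=\frac{2p}{2-p}$. Let $(t_j)_{j\in\mathbb Z}$ be real numbers such that the intervals $I_j=[t_j,t_{j+1})$, $j\in\mathbb Z$, form a partition of $\mathbb R$ (they are pairwise disjoint, with union $\mathbb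 R$; empty intervals are allowed). Set $k_j(t,s)=\chi_{I_j}(t)\,k(t,s)$ for $t,s\in\mathbb R$. Then $$\|k\|_{\mathfrak M_p}\le\left(\sum_{j\in\mathbb Z}\|k_j\|_{\mathfrak M_p}^{p^\flat}\right)^{1/p^\flat},$$ where the right-hand side may be $+\infty$. -/

import Mathlib

open MeasureTheory Set Function
open scoped ENNReal

/-- The complex Hilbert space `L_2(ℝ)` (Lebesgue measure). -/
abbrev L2R : Type := Lp ℂ 2 (volume : Measure ℝ)

/-- The complex space `L_2(ℝ²)` (Lebesgue measure). -/
abbrev L2R2 : Type := Lp ℂ 2 (volume : Measure (ℝ × ℝ))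

/-- The complex space `L_∞(ℝ²)` (Lebesgue measure). -/
abbrev LinftyR2 : Type := Lp ℂ ∞ (volume : Measure (ℝ × ℝ))

section IntegralOperator

lemma aestronglyMeasurable_kernel_mul (K : L2R2) (f : L2R) :
    AEStronglyMeasurable (fun z : ℝ × ℝ => K z * f z.1)
      ((volume : Measure ℝ).prod (volume : Measure ℝ)) :=
  (Lp.aestronglyMeasurable K).mul (Lp.aestronglyMeasurable f).comp_fst

lemma kernel_lintegral_le (K : L2R2) (f : L2R) :
    ∀ᵐ y : ℝ, ∫⁻ x, ‖K (x, y) * f x‖ₑ ≤ (∫⁻ x, ‖K (x, y)‖ₑ ^ (2 : ℝ)) ^ (1 / 2 : ℝ) * ‖f‖ₑ := by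
  have hK : AEStronglyMeasurable (fun z : ℝ × ℝ => K z.swap)
      ((volume : Measure ℝ).prod (volume : Measure ℝ)) :=
    (Lp.aestronglyMeasurable K).prod_swap
  filter_upwards [hK.prodMk_left] with y hy
  have h := ENNReal.lintegral_mul_le_Lp_mul_Lq (volume : Measure ℝ)
    (Real.HolderConjugate.two_two) hy.enorm (Lp.aestronglyMeasurable f).enorm
  simp only [enorm_mul]
  refine h.trans_eq ?_
  rw [Lp.enorm_def f, eLpNorm_eq_lintegral_rpow_enorm_toReal (by simp) (by simp)]
  simp

lemma kernel_sq_lintegral (K : L2R2) :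
    ∫⁻ y, ∫⁻ x, ‖K (x, y)‖ₑ ^ (2 : ℝ) = ‖K‖ₑ ^ (2 : ℝ) := by
  have hK : AEMeasurable (fun z : ℝ × ℝ => ‖K z‖ₑ ^ (2 : ℝ))
      ((volume : Measure ℝ).prod (volume : Measure ℝ)) :=
    (Lp.aestronglyMeasurable K).enorm.pow_const _
  rw [← lintegral_prod_symm _ hK, Lp.enorm_def K,
    eLpNorm_eq_lintegral_rpow_enorm_toReal (by simp) (by simp), ← ENNReal.rpow_mul]
  simp [Measure.volume_eq_prod]

lemma kernel_ae_integrable (K : L2R2) (f : L2R) :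
    ∀ᵐ y : ℝ, Integrable (fun x : ℝ => K (x, y) * f x) := by
  have hm : AEStronglyMeasurable (fun z : ℝ × ℝ => K z.swap * f z.2)
      ((volume : Measure ℝ).prod (volume : Measure ℝ)) :=
    (aestronglyMeasurable_kernel_mul K f).prod_swap
  have hK : AEMeasurable (fun z : ℝ × ℝ => ‖K z.swap‖ₑ ^ (2 : ℝ))
      ((volume : Measure ℝ).prod (volume : Measure ℝ)) :=
    (Lp.aestronglyMeasurable K).prod_swap.enorm.pow_const _
  have hfin := ae_lt_top' hK.lintegral_prod_right'
    (by
      have := kernel_sq_lintegral K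
      simp only [Prod.swap]
      rw [this]
      exact ENNReal.rpow_ne_top_of_nonneg (by norm_num) enorm_ne_top)
  filter_upwards [hm.prodMk_left, kernel_lintegral_le K f, hfin] with y h1 h2 h3
  refine ⟨h1, lt_of_le_of_lt h2 ?_⟩
  exact ENNReal.mul_lt_top (ENNReal.rpow_lt_top_of_nonneg (by norm_num) h3.ne) enorm_lt_top

lemma kernel_eLpNorm_le (K : L2R2) (f : L2R) :
    eLpNorm (fun y : ℝ => ∫ x, K (x, y) * f x) 2 volume ≤ ‖K‖ₑ * ‖f‖ₑ := by
  rw [eLpNorm_eq_lintegral_rpow_enorm_toReal (by simp) (by simp)]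
  have h : ∫⁻ y, ‖∫ x, K (x, y) * f x‖ₑ ^ (2 : ℝ) ≤ (‖K‖ₑ * ‖f‖ₑ) ^ (2 : ℝ) := by
    calc ∫⁻ y, ‖∫ x, K (x, y) * f x‖ₑ ^ (2 : ℝ)
        ≤ ∫⁻ y, (∫⁻ x, ‖K (x, y)‖ₑ ^ (2 : ℝ)) * ‖f‖ₑ ^ (2 : ℝ) := by
          refine lintegral_mono_ae ?_
          filter_upwards [kernel_lintegral_le K f] with y hy
          have h1 := (enorm_integral_le_lintegral_enorm (fun x => K (x, y) * f x)).trans hy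
          refine (ENNReal.rpow_le_rpow h1 (by norm_num : (0 : ℝ) ≤ 2)).trans_eq ?_
          rw [ENNReal.mul_rpow_of_nonneg _ _ (by norm_num), ← ENNReal.rpow_mul]
          norm_num
      _ = (‖K‖ₑ * ‖f‖ₑ) ^ (2 : ℝ) := by
          rw [lintegral_mul_const' _ _
            (ENNReal.rpow_ne_top_of_nonneg (by norm_num) enorm_ne_top),
            kernel_sq_lintegral, ENNReal.mul_rpow_of_nonneg _ _ (by norm_num)]
  rw [ENNReal.toReal_ofNat]
  refine (ENNReal.rpow_le_rpow (z := 1 / (2 : ℝ)) h (by norm_num)).trans_eq ?_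
  rw [← ENNReal.rpow_mul]
  norm_num

lemma kernel_memLp (K : L2R2) (f : L2R) :
    MemLp (fun y : ℝ => ∫ x, K (x, y) * f x) 2 volume := by
  refine ⟨(aestronglyMeasurable_kernel_mul K f).prod_swap.integral_prod_right', ?_⟩
  exact (kernel_eLpNorm_le K f).trans_lt (ENNReal.mul_lt_top enorm_lt_top enorm_lt_top)

/-- The integral operator with kernel `K ∈ L_2(ℝ²)`:
`Op(K) f (y) = ∫ K(x, y) f(x) dx` for `f ∈ L_2(ℝ)`, as a bounded operator on `L_2(ℝ)`. -/
noncomputable def Op (K : L2R2) : L2R →L[ℂ] L2R :=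
  LinearMap.mkContinuous
    { toFun := fun f => (kernel_memLp K f).toLp (fun y : ℝ => ∫ x, K (x, y) * f x)
      map_add' := fun f g => by
        rw [← MemLp.toLp_add]
        refine MemLp.toLp_congr _ _ ?_
        filter_upwards [kernel_ae_integrable K f, kernel_ae_integrable K g] with y hf hg
        rw [Pi.add_apply, ← integral_add hf hg]
        refine integral_congr_ae ?_
        filter_upwards [Lp.coeFn_add f g] with x hx
        rw [hx, Pi.add_apply, mul_add]
      map_smul' := fun c f => by
        rw [RingHom.id_apply, ← MemLp.toLp_const_smul]
        refine MemLp.toLp_congr _ _ ?_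
        refine Filter.Eventually.of_forall fun y => ?_
        simp only [Pi.smul_apply, smul_eq_mul]
        rw [← integral_const_mul]
        refine integral_congr_ae ?_
        filter_upwards [Lp.coeFn_smul c f] with x hx
        rw [hx, Pi.smul_apply, smul_eq_mul]
        ring }
    ‖K‖ (fun f => by
      have h := ENNReal.toReal_mono
        (ENNReal.mul_ne_top enorm_ne_top enorm_ne_top) (kernel_eLpNorm_le K f)
      simpa [Lp.norm_toLp] using h)

lemma Op_apply_ae (K : L2R2) (f : L2R) :
    ∀ᵐ y : ℝ, Op K f y = ∫ x, K (x, y) * f x :=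
  (kernel_memLp K f).coeFn_toLp

end IntegralOperator

/-- The `n`-th singular value
`μ(n, T) = inf {‖T - R‖ : R bounded, rank R ≤ n}` (operator norm). -/
noncomputable def singularNumber {H : Type*} [NormedAddCommGroup H] [InnerProductSpace ℂ H]
    (n : ℕ) (T : H →L[ℂ] H) : ℝ≥0∞ :=
  ⨅ (R : H →L[ℂ] H) (_ : LinearMap.rank (R : H →ₗ[ℂ] H) ≤ (n : Cardinal)), ‖T - R‖ₑ

/-- The Schatten--von Neumann quasi-norm
`‖T‖_p = (∑_{n ≥ 0} μ(n, T) ^ p) ^ (1 / p)`, with value `∞` exactly when `T ∉ 𝓛_p`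
(for `p > 0`; in particular when `T` is not compact). -/
noncomputable def schattenNorm {H : Type*} [NormedAddCommGroup H] [InnerProductSpace ℂ H]
    (p : ℝ) (T : H →L[ℂ] H) : ℝ≥0∞ :=
  (∑' n : ℕ, singularNumber n T ^ p) ^ (1 / p)

/-- The pointwise product `k φ ∈ L_2(ℝ²)` of `k ∈ L_∞(ℝ²)` and `φ ∈ L_2(ℝ²)`. -/
noncomputable def mulSymbol (k : LinftyR2) (φ : L2R2) : L2R2 :=
  ((Lp.memLp φ).mul' (Lp.memLp k)).toLp (fun z : ℝ × ℝ => k z * φ z)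

/-- The Schur multiplier quasi-norm
`‖k‖_{𝔐_p} = sup {‖Op(k φ)‖_p : φ ∈ L_2(ℝ²), ‖Op(φ)‖_p ≤ 1}`, with value `∞` when
`k` is not an `𝓛_p`-Schur multiplier. -/
noncomputable def schurNorm (p : ℝ) (k : LinftyR2) : ℝ≥0∞ :=
  ⨆ (φ : L2R2) (_ : schattenNorm p (Op φ) ≤ 1), schattenNorm p (Op (mulSymbol k φ))

/-- The function `(t, s) ↦ χ_I(t) k(t, s)`, for a measurable set `I ⊆ ℝ`,
as an element of `L_∞(ℝ²)`. -/
noncomputable def restrictFst (I : Set ℝ) (hI : MeasurableSet I) (k : LinftyR2) : LinftyR2 :=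
  ((Lp.memLp k).indicator (measurable_fst hI)).toLp
    ((Prod.fst ⁻¹' I).indicator (k : ℝ × ℝ → ℂ))

/-- The index `p^♭ = 2p / (2 - p)`. -/
noncomputable def pFlat (p : ℝ) : ℝ := 2 * p / (2 - p)

/-- The `ℓ_q(ℤ)` quasi-norm, `0 < q < ∞`, of a sequence of elements of `[0, ∞]`. -/
noncomputable def ellNorm (q : ℝ) (a : ℤ → ℝ≥0∞) : ℝ≥0∞ :=
  (∑' j : ℤ, a j ^ q) ^ (1 / q)

/-!
For `p ≤ 1` the `p`-th power of the Schatten quasi-norm is subadditive (Rotfel'd). Hence, after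
approximation by finite rank kernels and a singular value expansion, a Schur multiplier quasi-norm
can be tested on rank one kernels `u ⊗ v`. Such a kernel splits along the partition, with
`k (χ_j u ⊗ v) = k_j (χ_j u ⊗ v)` and `∑ ‖χ_j u‖ ^ 2 = ‖u‖ ^ 2`, so the pieces recombine by Hölder's
inequality for `1 / p = 1 / p^♭ + 1 / 2`.
-/

open InnerProductSpace
open scoped Topology

section RankOne

variable {𝕜 E F ι : Type*} [RCLike 𝕜]
  [NormedAddCommGroup E] [InnerProductSpace 𝕜 E] [NormedAddCommGroup F] [InnerProductSpace 𝕜 F]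

lemma norm_sum_smul_sq_of_orthonormal {v : ι → E} (hv : Orthonormal 𝕜 v) (c : ι → 𝕜)
    (S : Finset ι) : ‖∑ i ∈ S, c i • v i‖ ^ 2 = ∑ i ∈ S, ‖c i‖ ^ 2 := by
  simpa using hv.orthogonalFamily.norm_sum c S

lemma norm_sum_smul_rankOne_le {u : ι → E} {v : ι → F} (hu : Orthonormal 𝕜 u)
    (hv : Orthonormal 𝕜 v) {S : Finset ι} {c : ι → 𝕜} {M : ℝ} (hM : 0 ≤ M)
    (hc : ∀ i ∈ S, ‖c i‖ ≤ M) : ‖∑ i ∈ S, c i • rankOne 𝕜 (v i) (u i)‖ ≤ M := by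
  refine ContinuousLinearMap.opNorm_le_bound _ hM fun x => le_of_sq_le_sq ?_ (by positivity)
  calc ‖(∑ i ∈ S, c i • rankOne 𝕜 (v i) (u i)) x‖ ^ 2
      = ∑ i ∈ S, ‖c i‖ ^ 2 * ‖inner 𝕜 (u i) x‖ ^ 2 := by
        simp only [sum_apply, smul_apply, rankOne_apply, smul_smul,
          norm_sum_smul_sq_of_orthonormal hv, norm_mul, mul_pow]
    _ ≤ ∑ i ∈ S, M ^ 2 * ‖inner 𝕜 (u i) x‖ ^ 2 := by
        gcongr with i hi
        exact hc i hi
    _ ≤ (M * ‖x‖) ^ 2 := by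
        rw [← Finset.mul_sum, mul_pow]
        gcongr
        exact hu.sum_inner_products_le x

lemma norm_sum_rankOne_le_one {u : ι → E} {v : ι → F} (hu : Orthonormal 𝕜 u)
    (hv : Orthonormal 𝕜 v) (S : Finset ι) : ‖∑ i ∈ S, rankOne 𝕜 (v i) (u i)‖ ≤ 1 := by
  simpa using norm_sum_smul_rankOne_le hu hv (S := S) (c := 1) zero_le_one (by simp)

lemma rank_rankOne_le_one (x : E) (y : F) :
    LinearMap.rank (rankOne 𝕜 x y).toLinearMap ≤ 1 := by
  by_cases h : x = 0 ∨ y = 0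
  · simp [rankOne_eq_zero.2 h]
  · push Not at h
    exact (rank_rankOne h.1 h.2).le

lemma rank_sum_rankOne_le (S : Finset ι) (x : ι → E) (y : ι → F) :
    LinearMap.rank (∑ i ∈ S, rankOne 𝕜 (y i) (x i) : E →L[𝕜] F).toLinearMap ≤ S.card := by
  rw [ContinuousLinearMap.toLinearMap_sum]
  calc LinearMap.rank (∑ i ∈ S, (rankOne 𝕜 (y i) (x i)).toLinearMap)
      ≤ ∑ i ∈ S, LinearMap.rank (rankOne 𝕜 (y i) (x i)).toLinearMap :=
        LinearMap.rank_finsetSum_le S _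
    _ ≤ ∑ _i ∈ S, 1 := Finset.sum_le_sum fun i _ => rank_rankOne_le_one _ _
    _ = S.card := by simp

lemma finiteDimensional_range_sum_rankOne (S : Finset ι) (x : ι → E) (y : ι → F) :
    FiniteDimensional 𝕜 (∑ i ∈ S, rankOne 𝕜 (y i) (x i) : E →L[𝕜] F).range :=
  Module.rank_lt_aleph0_iff.1
    ((rank_sum_rankOne_le S x y).trans_lt Cardinal.natCast_lt_aleph0)

end RankOne

section SingularNumbers

variable {H : Type*} [NormedAddCommGroup H] [InnerProductSpace ℂ H]

lemma singularNumber_le_enorm_sub {n : ℕ} (T : H →L[ℂ] H) {R : H →L[ℂ] H}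
    (hR : LinearMap.rank (R : H →ₗ[ℂ] H) ≤ n) : singularNumber n T ≤ ‖T - R‖ₑ :=
  iInf₂_le R hR

lemma singularNumber_eq_zero {n : ℕ} {T : H →L[ℂ] H}
    (hT : LinearMap.rank (T : H →ₗ[ℂ] H) ≤ n) : singularNumber n T = 0 := by
  simpa [enorm_eq_nnnorm] using singularNumber_le_enorm_sub T hT

@[simp] lemma singularNumber_apply_zero (n : ℕ) : singularNumber n (0 : H →L[ℂ] H) = 0 :=
  singularNumber_eq_zero (by simp)

lemma singularNumber_zero (T : H →L[ℂ] H) : singularNumber 0 T = ‖T‖ₑ := by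
  refine le_antisymm ?_ (le_iInf₂ fun R hR => ?_)
  · simpa using singularNumber_le_enorm_sub (n := 0) T (R := 0) (by simp)
  · have hR0 : R = 0 := by
      have : LinearMap.range (R : H →ₗ[ℂ] H) = ⊥ := by
        simpa [LinearMap.rank] using hR
      exact ContinuousLinearMap.coe_injective (LinearMap.range_eq_bot.1 this)
    simp [hR0]

lemma singularNumber_le_add_edist (n : ℕ) (S T : H →L[ℂ] H) :
    singularNumber n S ≤ singularNumber n T + edist S T := by
  simp only [singularNumber, ENNReal.iInf_add]
  refine le_iInf₂ fun R hR => (iInf₂_le R hR).trans ?_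
  simpa only [edist_eq_enorm_sub, add_comm] using edist_triangle S T R

lemma continuous_singularNumber (n : ℕ) :
    Continuous (singularNumber n : (H →L[ℂ] H) → ℝ≥0∞) :=
  continuous_of_le_add_edist 1 ENNReal.one_ne_top fun S T => by
    simpa using singularNumber_le_add_edist n S T

lemma singularNumber_comp_le_right (n : ℕ) (B T : H →L[ℂ] H) :
    singularNumber n (B ∘L T) ≤ ‖B‖ₑ * singularNumber n T := by
  rcases eq_or_ne B 0 with rfl | hB
  · simp
  have hB0 : ‖B‖ₑ ≠ 0 := by simpa [enorm_eq_nnnorm] using hB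
  simp only [singularNumber, ENNReal.mul_iInf_of_ne hB0 enorm_ne_top]
  refine le_iInf₂ fun R hR => (singularNumber_le_enorm_sub (R := B ∘L R) _ ?_).trans ?_
  · exact (LinearMap.rank_comp_le_right (R : H →ₗ[ℂ] H) (B : H →ₗ[ℂ] H)).trans hR
  · rw [← ContinuousLinearMap.comp_sub]
    exact ContinuousLinearMap.opENorm_comp_le B (T - R)

lemma singularNumber_comp_le_left (n : ℕ) (T B : H →L[ℂ] H) :
    singularNumber n (T ∘L B) ≤ singularNumber n T * ‖B‖ₑ := by
  rcases eq_or_ne B 0 with rfl | hB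
  · simp
  have hB0 : ‖B‖ₑ ≠ 0 := by simpa [enorm_eq_nnnorm] using hB
  simp only [singularNumber, ENNReal.iInf_mul_of_ne hB0 enorm_ne_top]
  refine le_iInf₂ fun R hR => (singularNumber_le_enorm_sub (R := R ∘L B) _ ?_).trans ?_
  · exact (LinearMap.rank_comp_le_left (B : H →ₗ[ℂ] H) (R : H →ₗ[ℂ] H)).trans hR
  · rw [← ContinuousLinearMap.sub_comp]
    exact ContinuousLinearMap.opENorm_comp_le (T - R) B

lemma singularNumber_smul_le (n : ℕ) (c : ℂ) (T : H →L[ℂ] H) :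
    singularNumber n (c • T) ≤ ‖c‖ₑ * singularNumber n T := by
  have hc : ‖c • ContinuousLinearMap.id ℂ H‖ₑ ≤ ‖c‖ₑ := by
    refine ContinuousLinearMap.opENorm_le_bound _ fun x => ?_
    simp [enorm_smul]
  simpa using (singularNumber_comp_le_right n (c • ContinuousLinearMap.id ℂ H) T).trans
    (mul_le_mul_left hc _)

lemma ofReal_le_singularNumber {n : ℕ} {T : H →L[ℂ] H} {V : Submodule ℂ H}
    (hV : n < Module.finrank ℂ V) {c : ℝ} (h : ∀ x ∈ V, c * ‖x‖ ≤ ‖T x‖) :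
    ENNReal.ofReal c ≤ singularNumber n T := by
  refine le_iInf₂ fun R hR => ?_
  have : FiniteDimensional ℂ V := Module.finite_of_finrank_pos (by lia)
  let f : V →ₗ[ℂ] H := (R : H →ₗ[ℂ] H) ∘ₗ V.subtype
  have hf : Module.finrank ℂ (LinearMap.range f) ≤ n := by
    have := (LinearMap.rank_comp_le_left V.subtype (R : H →ₗ[ℂ] H)).trans hR
    rw [LinearMap.rank, ← Module.finrank_eq_rank] at this
    exact_mod_cast this
  have hker : 0 < Module.finrank ℂ (LinearMap.ker f) := by
    have := f.finrank_range_add_finrank_ker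
    lia
  obtain ⟨⟨⟨x, hxV⟩, hfx⟩, hx⟩ := Module.finrank_pos_iff_exists_ne_zero.1 hker
  have hRx : R x = 0 := hfx
  have hx0 : 0 < ‖x‖ := norm_pos_iff.2 (by simpa using hx)
  rw [← ofReal_norm]
  refine ENNReal.ofReal_le_ofReal (le_of_mul_le_mul_right ?_ hx0)
  calc c * ‖x‖ ≤ ‖(T - R) x‖ := by simpa [hRx] using h x hxV
    _ ≤ ‖T - R‖ * ‖x‖ := (T - R).le_opNorm x

end SingularNumbers

section SchattenSum

variable {H : Type*} [NormedAddCommGroup H] [InnerProductSpace ℂ H] {p : ℝ}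

/-- The `p`-th power `∑ n, μ(n, T) ^ p` of the Schatten quasi-norm: for `p ≤ 1` it is this power,
and not the quasi-norm itself, that is subadditive. -/
noncomputable def schattenSum (p : ℝ) (T : H →L[ℂ] H) : ℝ≥0∞ :=
  ∑' n : ℕ, singularNumber n T ^ p

lemma schattenNorm_eq_schattenSum_rpow (p : ℝ) (T : H →L[ℂ] H) :
    schattenNorm p T = schattenSum p T ^ (1 / p) := rfl

lemma schattenNorm_rpow (hp : p ≠ 0) (T : H →L[ℂ] H) :
    schattenNorm p T ^ p = schattenSum p T := by
  rw [schattenNorm_eq_schattenSum_rpow, ← ENNReal.rpow_mul, one_div_mul_cancel hp,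
    ENNReal.rpow_one]

lemma schattenSum_zero (hp : 0 < p) : schattenSum p (0 : H →L[ℂ] H) = 0 := by
  simp [schattenSum, hp]

lemma schattenSum_mono (hp : 0 ≤ p) {S T : H →L[ℂ] H}
    (h : ∀ n, singularNumber n S ≤ singularNumber n T) : schattenSum p S ≤ schattenSum p T :=
  ENNReal.tsum_le_tsum fun n => ENNReal.rpow_le_rpow (h n) hp

lemma schattenSum_comp_le_right (hp : 0 ≤ p) {B : H →L[ℂ] H} (hB : ‖B‖ ≤ 1) (T : H →L[ℂ] H) :
    schattenSum p (B ∘L T) ≤ schattenSum p T :=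
  schattenSum_mono hp fun n => (singularNumber_comp_le_right n B T).trans <|
    mul_le_of_le_one_left' (by simpa [← ofReal_norm] using hB)

lemma schattenSum_comp_le_left (hp : 0 ≤ p) {B : H →L[ℂ] H} (hB : ‖B‖ ≤ 1) (T : H →L[ℂ] H) :
    schattenSum p (T ∘L B) ≤ schattenSum p T :=
  schattenSum_mono hp fun n => (singularNumber_comp_le_left n T B).trans <|
    mul_le_of_le_one_right' (by simpa [← ofReal_norm] using hB)

lemma schattenNorm_smul_le (hp : 0 < p) (c : ℂ) (T : H →L[ℂ] H) :
    schattenNorm p (c • T) ≤ ‖c‖ₑ * schattenNorm p T := by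
  have h : schattenSum p (c • T) ≤ ‖c‖ₑ ^ p * schattenSum p T := by
    rw [schattenSum, schattenSum, ← ENNReal.tsum_mul_left]
    refine ENNReal.tsum_le_tsum fun n => ?_
    rw [← ENNReal.mul_rpow_of_nonneg _ _ hp.le]
    exact ENNReal.rpow_le_rpow (singularNumber_smul_le n c T) hp.le
  rw [← ENNReal.rpow_le_rpow_iff hp, ENNReal.mul_rpow_of_nonneg _ _ hp.le,
    schattenNorm_rpow hp.ne', schattenNorm_rpow hp.ne']
  exact h

lemma schattenNorm_eq_zero (hp : 0 < p) {T : H →L[ℂ] H} (h : schattenNorm p T = 0) : T = 0 := by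
  have hsum : schattenSum p T = 0 := by
    rw [← schattenNorm_rpow hp.ne', h, ENNReal.zero_rpow_of_pos hp]
  have h0 : singularNumber 0 T ^ p = 0 := ENNReal.tsum_eq_zero.1 hsum 0
  simpa [singularNumber_zero, enorm_eq_nnnorm, hp, hp.not_gt] using h0

lemma schattenSum_rankOne (hp : 0 < p) (x y : H) :
    schattenSum p (rankOne ℂ x y) = (‖x‖ₑ * ‖y‖ₑ) ^ p := by
  have hzero : ∀ n ≠ 0, singularNumber n (rankOne ℂ x y) = 0 := fun n hn =>
    singularNumber_eq_zero <| (rank_rankOne_le_one x y).trans <|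
      mod_cast Nat.one_le_iff_ne_zero.2 hn
  rw [schattenSum, tsum_eq_single 0 fun n hn => by simp [hzero n hn, hp], singularNumber_zero,
    enorm_rankOne]

lemma schattenNorm_rankOne (hp : 0 < p) (x y : H) :
    schattenNorm p (rankOne ℂ x y) = ‖x‖ₑ * ‖y‖ₑ := by
  rw [schattenNorm_eq_schattenSum_rpow, schattenSum_rankOne hp, one_div,
    ENNReal.rpow_rpow_inv hp.ne']

lemma lowerSemicontinuous_schattenSum (p : ℝ) :
    LowerSemicontinuous (schattenSum p : (H →L[ℂ] H) → ℝ≥0∞) :=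
  lowerSemicontinuous_tsum fun n =>
    (ENNReal.continuous_rpow_const.comp (continuous_singularNumber n)).lowerSemicontinuous

lemma isClosed_setOf_schattenSum_le (p : ℝ) (C : ℝ≥0∞) :
    IsClosed {T : H →L[ℂ] H | schattenSum p T ≤ C} :=
  (lowerSemicontinuous_schattenSum p).isClosed_preimage C

end SchattenSum

section SingularValueDecomposition

variable {H : Type*} [NormedAddCommGroup H] [InnerProductSpace ℂ H]
  {m : ℕ} {T : H →L[ℂ] H} {s : Fin m → ℝ} {u v : Fin m → H}

/-- A singular value decomposition `T = ∑ i, s i • ⟪u i, ·⟫ v i` of a finite rank operator, with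
`u`, `v` orthonormal and the positive singular values `s` listed in decreasing order. For `u = v` it
is a spectral decomposition of a positive operator. -/
structure IsSVD (T : H →L[ℂ] H) (s : Fin m → ℝ) (u v : Fin m → H) : Prop where
  pos : ∀ i, 0 < s i
  antitone : Antitone s
  left : Orthonormal ℂ u
  right : Orthonormal ℂ v
  eq_sum : T = ∑ i, (s i : ℂ) • rankOne ℂ (v i) (u i)

lemma IsSVD.apply_left (h : IsSVD T s u v) (i : Fin m) : T (u i) = (s i : ℂ) • v i := by
  rw [h.eq_sum]
  simp [orthonormal_iff_ite.1 h.left]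

lemma re_inner_rankOne_self_apply (z x : H) :
    (inner ℂ x (rankOne ℂ z z x)).re = ‖inner ℂ z x‖ ^ 2 := by
  rw [rankOne_apply, inner_smul_right, ← inner_conj_symm x z, Complex.mul_conj,
    Complex.ofReal_re, Complex.normSq_eq_norm_sq]

lemma IsSVD.re_inner_apply_self (h : IsSVD T s u u) (x : H) :
    (inner ℂ x (T x)).re = ∑ i, s i * ‖inner ℂ (u i) x‖ ^ 2 := by
  rw [h.eq_sum, sum_apply, inner_sum, Complex.re_sum]
  simp only [smul_apply, inner_smul_right, Complex.re_ofReal_mul, re_inner_rankOne_self_apply]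

lemma IsSVD.comp_sum_rankOne_left (h : IsSVD T s u v) :
    T ∘L ∑ i, rankOne ℂ (u i) (u i) = T := by
  conv_rhs => rw [h.eq_sum]
  simp [ContinuousLinearMap.comp_finsetSum, comp_rankOne, h.apply_left]

lemma comp_starProjection_range (hT : (T : H →ₗ[ℂ] H).IsSymmetric)
    [T.range.HasOrthogonalProjection] : T ∘L T.range.starProjection = T := by
  ext x
  have hx : x - T.range.starProjection x ∈ T.ker :=
    hT.orthogonal_range ▸ T.range.sub_starProjection_mem_orthogonal x
  rw [LinearMap.mem_ker, map_sub, sub_eq_zero] at hx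
  exact hx.symm

lemma exists_isSVD_of_isPositive {P : H →L[ℂ] H} (hP : P.IsPositive)
    [FiniteDimensional ℂ P.range] :
    ∃ (m : ℕ) (l : Fin m → ℝ) (w : Fin m → H), IsSVD P l w w := by
  have hsymm : (P : H →ₗ[ℂ] H).IsSymmetric := hP.isSymmetric
  have hinv : ∀ x ∈ P.range, (P : H →ₗ[ℂ] H) x ∈ P.range := fun x _ => LinearMap.mem_range_self _ x
  have hpos : ((P : H →ₗ[ℂ] H).restrict hinv).IsPositive :=
    ⟨hsymm.restrict_invariant hinv, fun x => hP.re_inner_nonneg_left x⟩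
  let b := hpos.isSymmetric.eigenvectorBasis rfl
  let l := hpos.isSymmetric.eigenvalues rfl
  have hb (i) : P (b i) = (l i : ℂ) • (b i : H) :=
    congrArg Subtype.val (hpos.isSymmetric.apply_eigenvectorBasis rfl i)
  have hl (i) : l i ≠ 0 := by
    intro hi
    have hbker : (b i : H) ∈ P.rangeᗮ := by
      rw [hsymm.orthogonal_range, LinearMap.mem_ker]
      simpa [hi] using hb i
    have hb0 : b i = 0 := Subtype.ext <|
      inner_self_eq_zero.1 (Submodule.inner_right_of_mem_orthogonal (b i).2 hbker)
    simpa [hb0] using b.orthonormal.1 i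
  have hbon : Orthonormal ℂ fun i => (b i : H) :=
    b.orthonormal.comp_linearIsometry P.range.subtypeₗᵢ
  refine ⟨_, l, fun i => b i, fun i => (hpos.nonneg_eigenvalues rfl i).lt_of_ne' (hl i),
    hpos.isSymmetric.eigenvalues_antitone rfl, hbon, hbon, ?_⟩
  conv_lhs => rw [← comp_starProjection_range hsymm, b.starProjection_eq_sum_rankOne]
  simp [ContinuousLinearMap.comp_finsetSum, comp_rankOne, hb]

lemma exists_isSVD [CompleteSpace H] (T : H →L[ℂ] H) [FiniteDimensional ℂ T.range] :
    ∃ (m : ℕ) (s : Fin m → ℝ) (u v : Fin m → H), IsSVD T s u v := by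
  have : FiniteDimensional ℂ (T.adjoint ∘L T).range := by
    rw [ContinuousLinearMap.toLinearMap_comp, LinearMap.range_comp]
    infer_instance
  obtain ⟨m, l, w, hP⟩ := exists_isSVD_of_isPositive T.isPositive_adjoint_comp_self
  have hinner (x y) : inner ℂ (T x) (T y) = inner ℂ x ((T.adjoint ∘L T) y) :=
    (T.adjoint_inner_right x (T y)).symm
  have hs (i) : ((√(l i) : ℝ) : ℂ) ≠ 0 := mod_cast (Real.sqrt_pos.2 (hP.pos i)).ne'
  have hsq (i) : ((√(l i) : ℝ) : ℂ) * √(l i) = l i := mod_cast Real.mul_self_sqrt (hP.pos i).le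
  have hTproj : T = T ∘L ∑ i, rankOne ℂ (w i) (w i) := by
    ext x
    have : x - (∑ i, rankOne ℂ (w i) (w i)) x ∈ (T.adjoint ∘L T).ker := by
      rw [LinearMap.mem_ker, map_sub, sub_eq_zero]
      exact (congrArg (· x) hP.comp_sum_rankOne_left).symm
    rw [T.ker_adjoint_comp_self, LinearMap.mem_ker, map_sub, sub_eq_zero] at this
    exact this
  refine ⟨m, fun i => √(l i), w, fun i => (√(l i) : ℂ)⁻¹ • T (w i),
    fun i => Real.sqrt_pos.2 (hP.pos i), fun i j hij => Real.sqrt_le_sqrt (hP.antitone hij),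
    hP.left, ?_, ?_⟩
  · rw [orthonormal_iff_ite]
    intro i j
    rw [inner_smul_left, inner_smul_right, hinner, hP.apply_left, inner_smul_right,
      orthonormal_iff_ite.1 hP.left, ← hsq]
    split_ifs with hij
    · subst hij
      simp [hs i]
    · simp
  · conv_lhs => rw [hTproj]
    simp [ContinuousLinearMap.comp_finsetSum, comp_rankOne, hs]

lemma finrank_span_Iic (hu : Orthonormal ℂ u) (i : Fin m) :
    (i : ℕ) < Module.finrank ℂ (Submodule.span ℂ (range fun j : Iic i => u j)) := by
  have hui : LinearIndependent ℂ fun j : Iic i => u j :=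
    hu.linearIndependent.comp _ Subtype.val_injective
  rw [finrank_span_eq_card hui]
  simp

lemma mul_norm_sq_le_sum_of_mem_span_Iic (hs : Antitone s) (hs0 : ∀ i, 0 ≤ s i)
    (hu : Orthonormal ℂ u) {i : Fin m} {x : H}
    (hx : x ∈ Submodule.span ℂ (range fun j : Iic i => u j)) :
    s i * ‖x‖ ^ 2 ≤ ∑ j, s j * ‖inner ℂ (u j) x‖ ^ 2 := by
  have hui : Orthonormal ℂ fun j : Iic i => u j := hu.comp _ Subtype.val_injective
  obtain ⟨c, rfl⟩ := (Submodule.mem_span_range_iff_exists_fun ℂ).1 hx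
  set x := ∑ j, c j • u j
  calc s i * ‖x‖ ^ 2 = ∑ j : Iic i, s i * ‖inner ℂ (u j) x‖ ^ 2 := by
        rw [norm_sum_smul_sq_of_orthonormal hui, Finset.mul_sum]
        exact Finset.sum_congr rfl fun j _ => by rw [hui.inner_right_fintype c j]
    _ ≤ ∑ j : Iic i, s j * ‖inner ℂ (u j) x‖ ^ 2 := by
        gcongr with j
        exact hs j.2
    _ = ∑ j with j ∈ Iic i, s j * ‖inner ℂ (u j) x‖ ^ 2 :=
        (Finset.sum_subtype _ (by simp) fun j => s j * ‖inner ℂ (u j) x‖ ^ 2).symm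
    _ ≤ ∑ j, s j * ‖inner ℂ (u j) x‖ ^ 2 :=
        Finset.sum_le_univ_sum_of_nonneg fun j => mul_nonneg (hs0 j) (sq_nonneg _)

lemma ofReal_le_singularNumber_of_sum_le_re_inner (hs : Antitone s) (hs0 : ∀ i, 0 ≤ s i)
    (hu : Orthonormal ℂ u)
    (hT : ∀ x, ∑ i, s i * ‖inner ℂ (u i) x‖ ^ 2 ≤ (inner ℂ x (T x)).re) (i : Fin m) :
    ENNReal.ofReal (s i) ≤ singularNumber i T := by
  refine ofReal_le_singularNumber (finrank_span_Iic hu i) fun x hx => ?_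
  rcases eq_or_ne x 0 with rfl | hx0
  · simp
  refine le_of_mul_le_mul_left ?_ (norm_pos_iff.2 hx0)
  calc ‖x‖ * (s i * ‖x‖) = s i * ‖x‖ ^ 2 := by ring
    _ ≤ ∑ j, s j * ‖inner ℂ (u j) x‖ ^ 2 := mul_norm_sq_le_sum_of_mem_span_Iic hs hs0 hu hx
    _ ≤ (inner ℂ x (T x)).re := hT x
    _ ≤ ‖x‖ * ‖T x‖ := re_inner_le_norm (𝕜 := ℂ) x (T x)

lemma sum_ofReal_rpow_le_schattenSum {p : ℝ} (hp : 0 ≤ p) (hs : Antitone s) (hs0 : ∀ i, 0 ≤ s i)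
    (hu : Orthonormal ℂ u)
    (hT : ∀ x, ∑ i, s i * ‖inner ℂ (u i) x‖ ^ 2 ≤ (inner ℂ x (T x)).re) :
    ∑ i, ENNReal.ofReal (s i) ^ p ≤ schattenSum p T := calc
  ∑ i, ENNReal.ofReal (s i) ^ p ≤ ∑ i : Fin m, singularNumber i T ^ p := by
    gcongr with i
    exact ofReal_le_singularNumber_of_sum_le_re_inner hs hs0 hu hT i
  _ = ∑ n ∈ Finset.range m, singularNumber n T ^ p :=
    (Finset.sum_range fun n => singularNumber n T ^ p).symm
  _ ≤ schattenSum p T := ENNReal.sum_le_tsum _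

namespace IsSVD

lemma sum_rankOne_comp (h : IsSVD T s u v) :
    IsSVD ((∑ i, rankOne ℂ (u i) (v i)) ∘L T) s u u where
  pos := h.pos
  antitone := h.antitone
  left := h.left
  right := h.left
  eq_sum := by
    conv_lhs => rw [h.eq_sum]
    simp [ContinuousLinearMap.comp_finsetSum, comp_rankOne, orthonormal_iff_ite.1 h.right]

lemma singularNumber_le (h : IsSVD T s u v) (i : Fin m) :
    singularNumber i T ≤ ENNReal.ofReal (s i) := by
  let R : H →L[ℂ] H := ∑ j with j < i, rankOne ℂ ((s j : ℂ) • v j) (u j)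
  have hR : LinearMap.rank R.toLinearMap ≤ (i : ℕ) :=
    (rank_sum_rankOne_le _ _ _).trans_eq (by rw [Finset.filter_gt_eq_Iio, Fin.card_Iio])
  have hTR : T - R = ∑ j with ¬ j < i, (s j : ℂ) • rankOne ℂ (v j) (u j) := by
    rw [h.eq_sum, ← Finset.sum_filter_add_sum_filter_not Finset.univ (· < i)]
    simp [R]
  refine (singularNumber_le_enorm_sub T hR).trans ?_
  rw [← ofReal_norm, hTR]
  refine ENNReal.ofReal_le_ofReal
    (norm_sum_smul_rankOne_le h.left h.right (h.pos i).le fun j hj => ?_)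
  simpa [abs_of_pos (h.pos j)] using h.antitone (by simpa using hj)

lemma singularNumber_eq_zero (h : IsSVD T s u v) {n : ℕ} (hn : m ≤ n) :
    singularNumber n T = 0 := by
  refine _root_.singularNumber_eq_zero (le_trans ?_ (Nat.cast_le.2 hn))
  rw [h.eq_sum]
  simpa using rank_sum_rankOne_le (𝕜 := ℂ) Finset.univ u fun j => (s j : ℂ) • v j

lemma schattenSum_eq (h : IsSVD T s u v) {p : ℝ} (hp : 0 < p) :
    schattenSum p T = ∑ i, ENNReal.ofReal (s i) ^ p := by
  refine le_antisymm ?_ ?_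
  · rw [schattenSum, tsum_eq_sum (s := Finset.range m), Finset.sum_range]
    · gcongr with i
      exact h.singularNumber_le i
    · intro n hn
      rw [h.singularNumber_eq_zero (by simpa using hn), ENNReal.zero_rpow_of_pos hp]
  · refine (sum_ofReal_rpow_le_schattenSum hp.le h.antitone (fun i => (h.pos i).le) h.left
      fun x => ?_).trans
      (schattenSum_comp_le_right hp.le (norm_sum_rankOne_le_one h.right h.left Finset.univ) T)
    exact (h.sum_rankOne_comp.re_inner_apply_self x).ge

end IsSVD

end SingularValueDecomposition

section Triangle

variable {H ι : Type*} [NormedAddCommGroup H] [InnerProductSpace ℂ H] {p : ℝ}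

lemma sum_mul_rpow_le_rpow_sum_mul {S : Finset ι} (hp0 : 0 < p) (hp1 : p ≤ 1) {w l : ι → ℝ}
    (hw : ∀ i, 0 ≤ w i) (hl : ∀ i, 0 ≤ l i) (hw1 : ∑ i ∈ S, w i ≤ 1) :
    ∑ i ∈ S, w i * l i ^ p ≤ (∑ i ∈ S, w i * l i) ^ p := by
  have hp1' : 1 ≤ p⁻¹ := (one_le_inv₀ hp0).2 hp1
  have hw0 : 0 ≤ ∑ i ∈ S, w i := Finset.sum_nonneg fun i _ => hw i
  have h := Real.inner_le_weight_mul_Lp_of_nonneg S hp1' w (fun i => l i ^ p)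
    hw fun i => Real.rpow_nonneg (hl i) p
  simp only [inv_inv, fun i => Real.rpow_rpow_inv (hl i) hp0.ne'] at h
  refine h.trans (mul_le_of_le_one_left ?_ ?_)
  · exact Real.rpow_nonneg (Finset.sum_nonneg fun i _ => mul_nonneg (hw i) (hl i)) p
  · exact Real.rpow_le_one hw0 hw1 (sub_nonneg.2 hp1)

lemma IsSVD.sum_norm_inner_sq_div_le_one {m : ℕ} {P : H →L[ℂ] H} {l : Fin m → ℝ} {w : Fin m → H}
    (hP : IsSVD P l w w) {z : H} (hz : ∀ x, ‖inner ℂ z x‖ ^ 2 ≤ (inner ℂ x (P x)).re) :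
    ∑ n, ‖inner ℂ (w n) z‖ ^ 2 / l n ≤ 1 := by
  set q := ∑ n, ‖inner ℂ (w n) z‖ ^ 2 / l n with hq
  let y : H := ∑ n, (inner ℂ (w n) z / l n) • w n
  have hzy : inner ℂ z y = (q : ℂ) := by
    rw [hq, Complex.ofReal_sum, inner_sum]
    refine Finset.sum_congr rfl fun n _ => ?_
    rw [inner_smul_right, ← inner_conj_symm z (w n), div_mul_eq_mul_div, Complex.mul_conj']
    push_cast
    rfl
  have hPy : (inner ℂ y (P y)).re = q := by
    rw [hP.re_inner_apply_self]
    refine Finset.sum_congr rfl fun n _ => ?_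
    have := hP.pos n
    rw [hP.left.inner_right_fintype, norm_div, Complex.norm_real, Real.norm_of_nonneg this.le]
    field_simp
  have hq2 : q ^ 2 ≤ q := by simpa [hzy, hPy] using hz y
  nlinarith

/-- Rotfel'd's inequality. The weights `‖⟪w n, z i⟫‖ ^ 2 / l n` sum to one over `i` and to at most
one over `n`, so concavity of `t ↦ t ^ p` applies for each `i`. -/
lemma IsSVD.sum_rpow_le_sum_norm_rpow [Fintype ι] (hp0 : 0 < p) (hp1 : p ≤ 1) {m : ℕ}
    {l : Fin m → ℝ} {w : Fin m → H} {z : ι → H}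
    (hP : IsSVD (∑ i, rankOne ℂ (z i) (z i)) l w w) :
    ∑ n, l n ^ p ≤ ∑ i, (‖z i‖ ^ 2) ^ p := by
  set P := ∑ i, rankOne ℂ (z i) (z i) with hPdef
  have hinner (x) : (inner ℂ x (P x)).re = ∑ i, ‖inner ℂ (z i) x‖ ^ 2 := by
    simp only [hPdef, sum_apply, inner_sum, Complex.re_sum, re_inner_rankOne_self_apply]
  have hl (n) : l n = ∑ i, ‖inner ℂ (w n) (z i)‖ ^ 2 := by
    simp only [norm_inner_symm (w n), ← hinner, hP.apply_left, inner_smul_right,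
      inner_self_eq_norm_sq_to_K, hP.left.1]
    simp
  have hdiv (i) : ∑ n, ‖inner ℂ (w n) (z i)‖ ^ 2 / l n ≤ 1 :=
    hP.sum_norm_inner_sq_div_le_one fun x => by
      rw [hinner]
      exact Finset.single_le_sum (f := fun i => ‖inner ℂ (z i) x‖ ^ 2)
        (fun i _ => sq_nonneg _) (Finset.mem_univ i)
  calc ∑ n, l n ^ p = ∑ n, (∑ i, ‖inner ℂ (w n) (z i)‖ ^ 2 / l n) * l n ^ p := by
        refine Finset.sum_congr rfl fun n _ => ?_
        rw [← Finset.sum_div, ← hl, div_self (hP.pos n).ne', one_mul]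
    _ = ∑ i, ∑ n, ‖inner ℂ (w n) (z i)‖ ^ 2 / l n * l n ^ p := by
        simp only [Finset.sum_mul]
        exact Finset.sum_comm
    _ ≤ ∑ i, (∑ n, ‖inner ℂ (w n) (z i)‖ ^ 2 / l n * l n) ^ p := by
        gcongr with i
        exact sum_mul_rpow_le_rpow_sum_mul hp0 hp1
          (fun n => div_nonneg (sq_nonneg _) (hP.pos n).le) (fun n => (hP.pos n).le) (hdiv i)
    _ ≤ ∑ i, (‖z i‖ ^ 2) ^ p := by
        simp only [div_mul_cancel₀ _ (hP.pos _).ne']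
        gcongr with i
        exact hP.left.sum_inner_products_le (z i)

/-- Polarization: `Re (a conj b) ≤ |(a + b) / 2| ^ 2` for `a = ⟪x, f⟫` and `b = ⟪y, f⟫`. -/
lemma re_inner_rankOne_apply_le (x y f : H) :
    (inner ℂ f (rankOne ℂ y x f)).re ≤ ‖inner ℂ ((1 / 2 : ℂ) • (x + y)) f‖ ^ 2 := by
  rw [rankOne_apply, inner_smul_right, ← inner_conj_symm f y, inner_smul_left, inner_add_left]
  generalize inner ℂ x f = a
  generalize inner ℂ y f = b
  rw [← Complex.normSq_eq_norm_sq, Complex.normSq_apply]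
  simp
  nlinarith [sq_nonneg (a.re - b.re), sq_nonneg (a.im - b.im)]

lemma norm_sub_starProjection_comp_le (T R : H →L[ℂ] H) [R.range.HasOrthogonalProjection] :
    ‖T - R.range.starProjection ∘L T‖ ≤ 2 * ‖T - R‖ := by
  have hR : R.range.starProjection ∘L R = R := by
    ext x
    exact R.range.starProjection_eq_self_iff.2 ⟨x, rfl⟩
  calc ‖T - R.range.starProjection ∘L T‖
      = ‖(T - R) - R.range.starProjection ∘L (T - R)‖ := by
        rw [ContinuousLinearMap.comp_sub, hR]
        abel_nf
    _ ≤ ‖T - R‖ + ‖R.range.starProjection‖ * ‖T - R‖ :=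
        (norm_sub_le _ _).trans (by gcongr; exact ContinuousLinearMap.opNorm_comp_le _ _)
    _ ≤ ‖T - R‖ + 1 * ‖T - R‖ := by
        gcongr
        exact R.range.starProjection_norm_le
    _ = 2 * ‖T - R‖ := by ring

lemma exists_finiteDimensional_range_norm_sub_lt (hp : 0 < p) {T : H →L[ℂ] H}
    (hT : schattenSum p T ≠ ∞) {ε : ℝ} (hε : 0 < ε) :
    ∃ R : H →L[ℂ] H, FiniteDimensional ℂ R.range ∧ ‖T - R‖ < ε := by
  have hpos : 0 < ENNReal.ofReal ε ^ p :=
    ENNReal.rpow_pos (ENNReal.ofReal_pos.2 hε) ENNReal.ofReal_ne_top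
  obtain ⟨n, hn⟩ := ((ENNReal.tendsto_atTop_zero_of_tsum_ne_top hT).eventually_lt_const hpos).exists
  rw [ENNReal.rpow_lt_rpow_iff hp, singularNumber] at hn
  simp only [iInf_lt_iff] at hn
  obtain ⟨R, hR, hlt⟩ := hn
  refine ⟨R, Module.rank_lt_aleph0_iff.1 (hR.trans_lt Cardinal.natCast_lt_aleph0), ?_⟩
  rwa [← ofReal_norm, ENNReal.ofReal_lt_ofReal_iff hε] at hlt

lemma mem_closure_setOf_finiteDimensional_range (hp : 0 < p) {T : H →L[ℂ] H}
    (hT : schattenSum p T ≠ ∞) :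
    T ∈ closure {S | FiniteDimensional ℂ S.range ∧ schattenSum p S ≤ schattenSum p T} := by
  refine Metric.mem_closure_iff.2 fun ε hε => ?_
  obtain ⟨R, hR, hTR⟩ := exists_finiteDimensional_range_norm_sub_lt hp hT (half_pos hε)
  refine ⟨R.range.starProjection ∘L T, ⟨?_, ?_⟩, ?_⟩
  · refine Submodule.finiteDimensional_of_le (S₂ := R.range) ?_
    rintro _ ⟨x, rfl⟩
    exact R.range.starProjection_apply_mem (T x)
  · exact schattenSum_comp_le_right hp.le R.range.starProjection_norm_le T
  · rw [dist_eq_norm]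
    linarith [norm_sub_starProjection_comp_le T R]

lemma schattenSum_sum_rankOne_self_le [Fintype ι] (hp0 : 0 < p) (hp1 : p ≤ 1) (z : ι → H) :
    schattenSum p (∑ i, rankOne ℂ (z i) (z i)) ≤ ∑ i, (‖z i‖ₑ ^ 2) ^ p := by
  have hpos : (∑ i, rankOne ℂ (z i) (z i)).IsPositive :=
    ContinuousLinearMap.isPositive_sum _ fun i _ => isPositive_rankOne_self (z i)
  have := finiteDimensional_range_sum_rankOne (𝕜 := ℂ) Finset.univ z z
  obtain ⟨m, l, w, hP⟩ := exists_isSVD_of_isPositive hpos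
  have h := ENNReal.ofReal_le_ofReal (hP.sum_rpow_le_sum_norm_rpow hp0 hp1)
  rw [ENNReal.ofReal_sum_of_nonneg fun n _ => Real.rpow_nonneg (hP.pos n).le p,
    ENNReal.ofReal_sum_of_nonneg fun i _ => by positivity] at h
  simp only [← ENNReal.ofReal_rpow_of_nonneg (hP.pos _).le hp0.le,
    ← ENNReal.ofReal_rpow_of_nonneg (sq_nonneg _) hp0.le,
    ENNReal.ofReal_pow (norm_nonneg _), ofReal_norm] at h
  exact (hP.schattenSum_eq hp0).trans_le h

variable [CompleteSpace H]

lemma schattenSum_sum_rankOne_le [Fintype ι] (hp0 : 0 < p) (hp1 : p ≤ 1) {x y : ι → H}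
    (hyx : ∀ i, ‖y i‖ ≤ ‖x i‖) :
    schattenSum p (∑ i, rankOne ℂ (y i) (x i)) ≤ ∑ i, (‖x i‖ₑ ^ 2) ^ p := by
  have := finiteDimensional_range_sum_rankOne (𝕜 := ℂ) Finset.univ x y
  obtain ⟨m, s, u, v, hT⟩ := exists_isSVD (∑ i, rankOne ℂ (y i) (x i))
  -- `U` turns the operator into its absolute value, to which polarization applies.
  let U : H →L[ℂ] H := ∑ n, rankOne ℂ (u n) (v n)
  have hU : ‖U‖ ≤ 1 := norm_sum_rankOne_le_one hT.right hT.left Finset.univ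
  have hUT : IsSVD (U ∘L ∑ i, rankOne ℂ (y i) (x i)) s u u := hT.sum_rankOne_comp
  let z : ι → H := fun i => (1 / 2 : ℂ) • (x i + U (y i))
  have hz (i) : ‖z i‖ ≤ ‖x i‖ := by
    have h1 := norm_add_le (x i) (U (y i))
    have h2 := U.le_of_opNorm_le hU (y i)
    have h3 := hyx i
    rw [norm_smul]
    norm_num
    linarith
  calc schattenSum p (∑ i, rankOne ℂ (y i) (x i))
      = ∑ n, ENNReal.ofReal (s n) ^ p := hT.schattenSum_eq hp0
    _ ≤ schattenSum p (∑ i, rankOne ℂ (z i) (z i)) := by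
        refine sum_ofReal_rpow_le_schattenSum hp0.le hT.antitone (fun n => (hT.pos n).le) hT.left
          fun f => ?_
        rw [← hUT.re_inner_apply_self]
        simp only [ContinuousLinearMap.comp_finsetSum, comp_rankOne, sum_apply, inner_sum,
          Complex.re_sum]
        refine Finset.sum_le_sum fun i _ => ?_
        rw [re_inner_rankOne_self_apply]
        exact re_inner_rankOne_apply_le (x i) (U (y i)) f
    _ ≤ ∑ i, (‖z i‖ₑ ^ 2) ^ p := schattenSum_sum_rankOne_self_le hp0 hp1 z
    _ ≤ ∑ i, (‖x i‖ₑ ^ 2) ^ p := by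
        gcongr with i
        exact enorm_le_iff_norm_le.2 (hz i)

lemma exists_eq_sum_rankOne (hp : 0 < p) (T : H →L[ℂ] H) [FiniteDimensional ℂ T.range] :
    ∃ (m : ℕ) (x y : Fin m → H), (∀ i, ‖y i‖ = ‖x i‖) ∧ T = ∑ i, rankOne ℂ (y i) (x i) ∧
      schattenSum p T = ∑ i, (‖x i‖ₑ ^ 2) ^ p := by
  obtain ⟨m, s, u, v, hT⟩ := exists_isSVD T
  have hsq (i) : √(s i) * √(s i) = s i := Real.mul_self_sqrt (hT.pos i).le
  refine ⟨m, fun i => (√(s i) : ℂ) • u i, fun i => (√(s i) : ℂ) • v i, fun i => ?_, ?_, ?_⟩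
  · simp [norm_smul, hT.left.1, hT.right.1]
  · rw [hT.eq_sum]
    refine Finset.sum_congr rfl fun i _ => ?_
    ext f
    simp only [smul_apply, rankOne_apply, inner_smul_left, Complex.conj_ofReal, smul_smul]
    rw [mul_right_comm, ← Complex.ofReal_mul, hsq]
  · rw [hT.schattenSum_eq hp]
    refine Finset.sum_congr rfl fun i _ => ?_
    rw [← ofReal_norm, norm_smul, hT.left.1, mul_one, Complex.norm_real, Real.norm_eq_abs,
      ← ENNReal.ofReal_pow (abs_nonneg _), sq_abs, sq, hsq]

lemma schattenSum_add_le_of_finiteDimensional (hp0 : 0 < p) (hp1 : p ≤ 1) (S T : H →L[ℂ] H)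
    [FiniteDimensional ℂ S.range] [FiniteDimensional ℂ T.range] :
    schattenSum p (S + T) ≤ schattenSum p S + schattenSum p T := by
  obtain ⟨m, x, y, hxy, hS, hSsum⟩ := exists_eq_sum_rankOne hp0 S
  obtain ⟨n, x', y', hxy', hT, hTsum⟩ := exists_eq_sum_rankOne hp0 T
  have h := schattenSum_sum_rankOne_le hp0 hp1 (x := Sum.elim x x') (y := Sum.elim y y')
    (Sum.rec (fun i => (hxy i).le) fun i => (hxy' i).le)
  simpa only [Fintype.sum_sum_type, Sum.elim_inl, Sum.elim_inr, ← hS, ← hT, ← hSsum, ← hTsum]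
    using h

lemma schattenSum_add_le (hp0 : 0 < p) (hp1 : p ≤ 1) (S T : H →L[ℂ] H) :
    schattenSum p (S + T) ≤ schattenSum p S + schattenSum p T := by
  rcases eq_or_ne (schattenSum p S) ∞ with hS | hS
  · simp [hS]
  rcases eq_or_ne (schattenSum p T) ∞ with hT | hT
  · simp [hT]
  refine (isClosed_setOf_schattenSum_le p _).closure_subset <| map_mem_closure₂ continuous_add
    (mem_closure_setOf_finiteDimensional_range hp0 hS)
    (mem_closure_setOf_finiteDimensional_range hp0 hT) ?_
  rintro S' ⟨hS'fin, hS'⟩ T' ⟨hT'fin, hT'⟩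
  exact (schattenSum_add_le_of_finiteDimensional hp0 hp1 S' T').trans (add_le_add hS' hT')

lemma schattenSum_finset_sum_le (hp0 : 0 < p) (hp1 : p ≤ 1) (s : Finset ι) (T : ι → H →L[ℂ] H) :
    schattenSum p (∑ i ∈ s, T i) ≤ ∑ i ∈ s, schattenSum p (T i) :=
  Finset.le_sum_of_subadditive _ (schattenSum_zero hp0).le (schattenSum_add_le hp0 hp1) s T

lemma schattenSum_le_tsum (hp0 : 0 < p) (hp1 : p ≤ 1) {S : H →L[ℂ] H} {T : ι → H →L[ℂ] H}
    (h : HasSum T S) : schattenSum p S ≤ ∑' i, schattenSum p (T i) :=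
  (isClosed_setOf_schattenSum_le p _).mem_of_tendsto h <| .of_forall fun s =>
    (schattenSum_finset_sum_le hp0 hp1 s T).trans (ENNReal.sum_le_tsum s)

end Triangle

section HilbertSpace

variable {𝕜 E ι : Type*} [RCLike 𝕜] [NormedAddCommGroup E] [InnerProductSpace 𝕜 E]

lemma norm_sub_sum_sq_of_inner_eq_norm_sq {a : ι → E} {b : E}
    (horth : Pairwise fun i j => inner 𝕜 (a i) (a j) = 0)
    (hb : ∀ i, inner 𝕜 (a i) b = (‖a i‖ : 𝕜) ^ 2) (s : Finset ι) :
    ‖b - ∑ i ∈ s, a i‖ ^ 2 = ‖b‖ ^ 2 - ∑ i ∈ s, ‖a i‖ ^ 2 := by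
  have hself (i) (hi : i ∈ s) : inner 𝕜 (a i) (∑ j ∈ s, a j) = (‖a i‖ : 𝕜) ^ 2 := by
    rw [inner_sum, Finset.sum_eq_single_of_mem i hi fun j _ hji => horth hji.symm,
      inner_self_eq_norm_sq_to_K]
  have hsum : inner 𝕜 (∑ i ∈ s, a i) b = ((∑ i ∈ s, ‖a i‖ ^ 2 : ℝ) : 𝕜) := by
    simp [sum_inner, hb]
  have hnorm : ‖∑ i ∈ s, a i‖ ^ 2 = ∑ i ∈ s, ‖a i‖ ^ 2 := by
    rw [← RCLike.ofReal_inj (K := 𝕜), RCLike.ofReal_pow, ← inner_self_eq_norm_sq_to_K, sum_inner,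
      Finset.sum_congr rfl hself]
    simp
  rw [norm_sub_sq (𝕜 := 𝕜), ← inner_conj_symm, hsum, RCLike.conj_ofReal, RCLike.ofReal_re, hnorm]
  ring

lemma hasSum_of_tsum_enorm_sq_eq {a : ι → E} {b : E}
    (horth : Pairwise fun i j => inner 𝕜 (a i) (a j) = 0)
    (hb : ∀ i, inner 𝕜 (a i) b = (‖a i‖ : 𝕜) ^ 2) (hsum : ∑' i, ‖a i‖ₑ ^ 2 = ‖b‖ₑ ^ 2) :
    HasSum a b := by
  have hsum' : HasSum (fun i => ‖a i‖ ^ 2) (‖b‖ ^ 2) := by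
    have h := ENNReal.hasSum_toReal (hsum.trans_ne (by simp))
    rw [← ENNReal.tsum_toReal_eq fun i => by simp, hsum] at h
    simpa using h
  have hsub : Filter.Tendsto (fun s => ‖b - ∑ i ∈ s, a i‖ ^ 2) Filter.atTop (𝓝 0) := by
    simp only [norm_sub_sum_sq_of_inner_eq_norm_sq horth hb]
    rw [← sub_self (‖b‖ ^ 2)]
    exact hsum'.const_sub (‖b‖ ^ 2)
  rw [HasSum, SummationFilter.unconditional_filter, tendsto_iff_norm_sub_tendsto_zero]
  simpa [norm_sub_rev, Real.sqrt_sq (norm_nonneg _)] using hsub.sqrt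

lemma tsum_enorm_inner_sq_eq_enorm_sq (e : HilbertBasis ι 𝕜 E) (x : E) :
    ∑' i, ‖inner 𝕜 (e i) x‖ₑ ^ 2 = ‖x‖ₑ ^ 2 := by
  have h : HasSum (fun i => ‖inner 𝕜 (e i) x‖ ^ 2) (‖x‖ ^ 2) := by
    simpa [e.repr_apply_apply] using lp.hasSum_norm (by norm_num) (e.repr x)
  simp only [← ofReal_norm, ← ENNReal.ofReal_pow (norm_nonneg _)]
  rw [← ENNReal.ofReal_tsum_of_nonneg (fun i => sq_nonneg _) h.summable, h.tsum_eq]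

lemma countable_of_orthonormal [TopologicalSpace.SeparableSpace E] {e : ι → E}
    (he : Orthonormal 𝕜 e) : Countable ι := by
  have hdist (i j) (hij : i ≠ j) : 1 ≤ dist (e i) (e j) := by
    have h : ‖e i - e j‖ ^ 2 = 2 := by
      rw [norm_sub_sq (𝕜 := 𝕜), he.1, he.1, he.2 hij]
      norm_num
    rw [dist_eq_norm]
    nlinarith [norm_nonneg (e i - e j)]
  refine Pairwise.countable_of_isOpen_disjoint (s := fun i => Metric.ball (e i) (1 / 2))
    (fun i j hij => Metric.ball_disjoint_ball ?_) (fun i => Metric.isOpen_ball)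
    fun i => Metric.nonempty_ball.2 (by norm_num)
  linarith [hdist i j hij]

lemma exists_countable_hilbertBasis (𝕜 E : Type*) [RCLike 𝕜] [NormedAddCommGroup E]
    [InnerProductSpace 𝕜 E] [CompleteSpace E] [TopologicalSpace.SeparableSpace E] :
    ∃ w : Set E, Countable w ∧ Nonempty (HilbertBasis w 𝕜 E) := by
  obtain ⟨w, e, -⟩ := exists_hilbertBasis 𝕜 E
  exact ⟨w, countable_of_orthonormal e.orthonormal, ⟨e⟩⟩

end HilbertSpace

section SquareIntegrable

variable {α E : Type*} [MeasurableSpace α] {μ : Measure α} [NormedAddCommGroup E]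

lemma lintegral_enorm_sq_eq_eLpNorm_sq (f : α → E) :
    ∫⁻ x, ‖f x‖ₑ ^ 2 ∂μ = eLpNorm f 2 μ ^ 2 := by
  simpa using (eLpNorm_nnreal_pow_eq_lintegral (f := f) (μ := μ) (two_ne_zero (α := NNReal))).symm

lemma lintegral_enorm_sq_eq_enorm_sq (f : Lp E 2 μ) : ∫⁻ x, ‖f x‖ₑ ^ 2 ∂μ = ‖f‖ₑ ^ 2 := by
  rw [lintegral_enorm_sq_eq_eLpNorm_sq, Lp.enorm_def]

/-- Multiplication of `f ∈ L_p` by the indicator function of `I`. -/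
noncomputable def indicatorLp {p : ℝ≥0∞} (I : Set α) (hI : MeasurableSet I) (f : Lp E p μ) :
    Lp E p μ :=
  ((Lp.memLp f).indicator hI).toLp (I.indicator f)

lemma coeFn_indicatorLp {p : ℝ≥0∞} {I : Set α} (hI : MeasurableSet I) (f : Lp E p μ) :
    indicatorLp I hI f =ᵐ[μ] I.indicator f :=
  ((Lp.memLp f).indicator hI).coeFn_toLp

lemma indicatorLp_indicatorLp_self {p : ℝ≥0∞} {I : Set α} (hI : MeasurableSet I) (f : Lp E p μ) :
    indicatorLp I hI (indicatorLp I hI f) = indicatorLp I hI f := by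
  refine Lp.ext ?_
  filter_upwards [coeFn_indicatorLp hI f, coeFn_indicatorLp hI (indicatorLp I hI f)] with x hf hf'
  rw [hf']
  by_cases hx : x ∈ I <;> simp [hx, hf]

lemma enorm_indicatorLp_sq {I : Set α} (hI : MeasurableSet I) (f : Lp E 2 μ) :
    ‖indicatorLp I hI f‖ₑ ^ 2 = ∫⁻ x in I, ‖f x‖ₑ ^ 2 ∂μ := by
  rw [indicatorLp, Lp.enorm_toLp, eLpNorm_indicator_eq_eLpNorm_restrict hI,
    lintegral_enorm_sq_eq_eLpNorm_sq]

variable {𝕜 ι : Type*} [RCLike 𝕜] [InnerProductSpace 𝕜 E]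

lemma inner_indicatorLp_of_disjoint {I J : Set α} (hI : MeasurableSet I) (hJ : MeasurableSet J)
    (hIJ : Disjoint I J) (f g : Lp E 2 μ) :
    inner 𝕜 (indicatorLp I hI f) (indicatorLp J hJ g) = 0 := by
  rw [L2.inner_def]
  refine integral_eq_zero_of_ae ?_
  filter_upwards [coeFn_indicatorLp hI f, coeFn_indicatorLp hJ g] with x hf hg
  rw [hf, hg]
  by_cases hx : x ∈ I
  · simp [hIJ.notMem_of_mem_left hx]
  · simp [hx]

lemma inner_indicatorLp_left {I : Set α} (hI : MeasurableSet I) (f : Lp E 2 μ) :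
    inner 𝕜 (indicatorLp I hI f) f = (‖indicatorLp I hI f‖ : 𝕜) ^ 2 := by
  rw [← inner_self_eq_norm_sq_to_K, L2.inner_def, L2.inner_def]
  refine integral_congr_ae ?_
  filter_upwards [coeFn_indicatorLp hI f] with x hf
  by_cases hx : x ∈ I <;> simp [hf, hx]

variable [Countable ι] {I : ι → Set α} (hI : ∀ j, MeasurableSet (I j))

lemma tsum_enorm_indicatorLp_sq (hdisj : Pairwise (Disjoint on I)) (hcover : ⋃ j, I j = univ)
    (f : Lp E 2 μ) : ∑' j, ‖indicatorLp (I j) (hI j) f‖ₑ ^ 2 = ‖f‖ₑ ^ 2 := by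
  simp only [enorm_indicatorLp_sq]
  rw [← lintegral_iUnion hI hdisj, hcover, setLIntegral_univ, lintegral_enorm_sq_eq_enorm_sq]

lemma hasSum_indicatorLp (hdisj : Pairwise (Disjoint on I)) (hcover : ⋃ j, I j = univ)
    (f : Lp 𝕜 2 μ) : HasSum (fun j => indicatorLp (I j) (hI j) f) f :=
  hasSum_of_tsum_enorm_sq_eq (𝕜 := 𝕜)
    (fun i j hij => inner_indicatorLp_of_disjoint (hI i) (hI j) (hdisj hij) f f)
    (fun j => inner_indicatorLp_left (hI j) f) (tsum_enorm_indicatorLp_sq hI hdisj hcover f)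

end SquareIntegrable

section Kernels

lemma memLp_conj_mul (u v : L2R) :
    MemLp (fun z : ℝ × ℝ => starRingEnd ℂ (u z.1) * v z.2) 2 volume := by
  have hm : AEStronglyMeasurable (fun z : ℝ × ℝ => starRingEnd ℂ (u z.1) * v z.2) volume :=
    (Complex.continuous_conj.comp_aestronglyMeasurable
      (Lp.aestronglyMeasurable u).comp_fst).mul (Lp.aestronglyMeasurable v).comp_snd
  have hsq (f : L2R) : Integrable fun x => ‖f x‖ ^ 2 :=
    (memLp_two_iff_integrable_sq_norm (Lp.aestronglyMeasurable f)).1 (Lp.memLp f)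
  rw [memLp_two_iff_integrable_sq_norm hm]
  simpa [mul_pow, Measure.volume_eq_prod] using (hsq u).mul_prod (hsq v)

/-- The kernel `(x, y) ↦ conj (u x) * v y` of the rank one operator `⟪u, ·⟫ v`. -/
noncomputable def rankOneKernel (u v : L2R) : L2R2 := (memLp_conj_mul u v).toLp _

lemma coeFn_rankOneKernel (u v : L2R) :
    rankOneKernel u v =ᵐ[volume] fun z => starRingEnd ℂ (u z.1) * v z.2 :=
  (memLp_conj_mul u v).coeFn_toLp

lemma inner_rankOneKernel (u v : L2R) (φ : L2R2) :
    inner ℂ (rankOneKernel u v) φ = inner ℂ v (Op φ u) := by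
  have hint := L2.integrable_inner (𝕜 := ℂ) (rankOneKernel u v) φ
  have hae : (fun z : ℝ × ℝ => inner ℂ (rankOneKernel u v z) (φ z)) =ᵐ[volume]
      fun z => starRingEnd ℂ (v z.2) * (φ z * u z.1) := by
    filter_upwards [coeFn_rankOneKernel u v] with z hz
    rw [hz, RCLike.inner_apply, map_mul, Complex.conj_conj]
    ring
  rw [L2.inner_def, integral_congr_ae hae, L2.inner_def]
  refine (integral_prod_symm _ (hint.congr hae)).trans (integral_congr_ae ?_)
  filter_upwards [Op_apply_ae φ u] with y hy
  rw [hy, RCLike.inner_apply, integral_const_mul, mul_comm]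

lemma inner_rankOneKernel_rankOneKernel (u v u' v' : L2R) :
    inner ℂ (rankOneKernel u v) (rankOneKernel u' v') = inner ℂ u' u * inner ℂ v v' := by
  have hae : (fun z : ℝ × ℝ => inner ℂ (rankOneKernel u v z) (rankOneKernel u' v' z)) =ᵐ[volume]
      fun z => inner ℂ (u' z.1) (u z.1) * inner ℂ (v z.2) (v' z.2) := by
    filter_upwards [coeFn_rankOneKernel u v, coeFn_rankOneKernel u' v'] with z hz hz'
    simp only [hz, hz', RCLike.inner_apply, map_mul, Complex.conj_conj]
    ring
  rw [L2.inner_def, integral_congr_ae hae, Measure.volume_eq_prod,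
    integral_prod_mul (fun x => inner ℂ (u' x) (u x)) (fun y => inner ℂ (v y) (v' y)),
    L2.inner_def, L2.inner_def]

lemma norm_rankOneKernel (u v : L2R) : ‖rankOneKernel u v‖ = ‖u‖ * ‖v‖ := by
  have h := inner_rankOneKernel_rankOneKernel u v u v
  simp only [inner_self_eq_norm_sq_to_K, ← mul_pow] at h
  exact (sq_eq_sq₀ (norm_nonneg _) (by positivity)).1 (mod_cast h)

lemma norm_Op_le (φ : L2R2) : ‖Op φ‖ ≤ ‖φ‖ :=
  LinearMap.mkContinuous_norm_le _ (norm_nonneg _) _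

/-- `φ ↦ Op φ` as a continuous linear map. -/
noncomputable def opL : L2R2 →L[ℂ] L2R →L[ℂ] L2R :=
  LinearMap.mkContinuous
    { toFun := Op
      map_add' := fun φ ψ => ContinuousLinearMap.ext fun u => ext_inner_left ℂ fun v => by
        simp only [add_apply, inner_add_right, ← inner_rankOneKernel]
      map_smul' := fun c φ => ContinuousLinearMap.ext fun u => ext_inner_left ℂ fun v => by
        simp only [smul_apply, inner_smul_right, ← inner_rankOneKernel, RingHom.id_apply] }
    1 fun φ => (norm_Op_le φ).trans_eq (one_mul _).symm

lemma opL_apply (φ : L2R2) : opL φ = Op φ := rfl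

lemma Op_rankOneKernel (u v : L2R) : Op (rankOneKernel u v) = rankOne ℂ v u := by
  refine ContinuousLinearMap.ext fun f => ext_inner_left ℂ fun g => ?_
  rw [← inner_rankOneKernel, inner_rankOneKernel_rankOneKernel, rankOne_apply, inner_smul_right]

lemma ae_memLp_conj_kernel (φ : L2R2) :
    ∀ᵐ y : ℝ, MemLp (fun x => starRingEnd ℂ (φ (x, y))) 2 volume := by
  have hmeas : AEStronglyMeasurable (fun z : ℝ × ℝ => φ z.swap)
      ((volume : Measure ℝ).prod (volume : Measure ℝ)) :=
    (Lp.aestronglyMeasurable φ).prod_swap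
  have hfin : ∀ᵐ y : ℝ, ∫⁻ x, ‖φ (x, y)‖ₑ ^ (2 : ℝ) < ∞ :=
    ae_lt_top' (hmeas.enorm.pow_const (2 : ℝ)).lintegral_prod_right'
      ((kernel_sq_lintegral φ).trans_ne (by simp))
  filter_upwards [hmeas.prodMk_left, hfin] with y hm hlt
  refine ⟨Complex.continuous_conj.comp_aestronglyMeasurable hm, ?_⟩
  rw [eLpNorm_lt_top_iff_lintegral_rpow_enorm_lt_top (by simp) (by simp)]
  simpa using hlt

lemma ae_tsum_enorm_Op_apply_sq {ι : Type*} [Countable ι] (e : HilbertBasis ι ℂ L2R) (φ : L2R2) :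
    ∀ᵐ y : ℝ, ∑' i, ‖Op φ (e i) y‖ₑ ^ 2 = ∫⁻ x, ‖φ (x, y)‖ₑ ^ 2 := by
  filter_upwards [ae_memLp_conj_kernel φ, ae_all_iff.2 fun i => Op_apply_ae φ (e i)] with y hφ hOp
  have hinner (i) : ‖Op φ (e i) y‖ₑ = ‖inner ℂ (e i) (hφ.toLp _)‖ₑ := by
    rw [hOp, ← ofReal_norm, ← ofReal_norm, norm_inner_symm, L2.inner_def]
    congr 2
    refine integral_congr_ae ?_
    filter_upwards [hφ.coeFn_toLp] with x hx
    rw [hx, RCLike.inner_apply, Complex.conj_conj, mul_comm]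
  simp only [hinner, tsum_enorm_inner_sq_eq_enorm_sq]
  rw [Lp.enorm_toLp, ← lintegral_enorm_sq_eq_eLpNorm_sq]
  simp

lemma tsum_enorm_Op_apply_sq {ι : Type*} [Countable ι] (e : HilbertBasis ι ℂ L2R) (φ : L2R2) :
    ∑' i, ‖Op φ (e i)‖ₑ ^ 2 = ‖φ‖ₑ ^ 2 := by
  simp only [← lintegral_enorm_sq_eq_enorm_sq (Op φ _)]
  rw [← lintegral_tsum fun i => (Lp.aestronglyMeasurable _).enorm.pow_const 2,
    lintegral_congr_ae (ae_tsum_enorm_Op_apply_sq e φ)]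
  simpa using kernel_sq_lintegral φ

lemma hasSum_rankOneKernel {ι : Type*} [Countable ι] (e : HilbertBasis ι ℂ L2R) (φ : L2R2) :
    HasSum (fun i => rankOneKernel (e i) (Op φ (e i))) φ := by
  refine hasSum_of_tsum_enorm_sq_eq (𝕜 := ℂ) (fun i j hij => ?_) (fun i => ?_) ?_
  · simp only [inner_rankOneKernel_rankOneKernel, e.orthonormal.2 hij.symm, zero_mul]
  · rw [inner_rankOneKernel, inner_self_eq_norm_sq_to_K, norm_rankOneKernel, e.orthonormal.1,
      one_mul]
  · simpa [← ofReal_norm, norm_rankOneKernel, e.orthonormal.1] using tsum_enorm_Op_apply_sq e φ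

instance separableSpace_L2R : TopologicalSpace.SeparableSpace L2R :=
  have : Fact ((2 : ℝ≥0∞) ≠ ∞) := ⟨ENNReal.ofNat_ne_top⟩
  inferInstance

lemma Op_injective : Injective Op := fun φ ψ h => by
  obtain ⟨w, _, ⟨e⟩⟩ := exists_countable_hilbertBasis ℂ L2R
  exact (hasSum_rankOneKernel e φ).unique (h ▸ hasSum_rankOneKernel e ψ)

lemma mem_closure_setOf_finiteDimensional_range_Op {p : ℝ} (hp : 0 ≤ p) (φ : L2R2) :
    φ ∈ closure {ψ | FiniteDimensional ℂ (Op ψ).range ∧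
      schattenSum p (Op ψ) ≤ schattenSum p (Op φ)} := by
  obtain ⟨w, _, ⟨e⟩⟩ := exists_countable_hilbertBasis ℂ L2R
  refine mem_closure_of_tendsto (hasSum_rankOneKernel e φ) (.of_forall fun s => ?_)
  have hsum : Op (∑ i ∈ s, rankOneKernel (e i) (Op φ (e i))) =
      ∑ i ∈ s, rankOne ℂ (Op φ (e i)) (e i) := by
    simp only [← opL_apply, map_sum]
    simp only [opL_apply, Op_rankOneKernel]
  have hcomp : ∑ i ∈ s, rankOne ℂ (Op φ (e i)) (e i) = Op φ ∘L ∑ i ∈ s, rankOne ℂ (e i) (e i) := by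
    simp only [ContinuousLinearMap.comp_finsetSum, comp_rankOne]
  refine ⟨?_, ?_⟩
  · rw [hsum]
    exact finiteDimensional_range_sum_rankOne s _ _
  · rw [hsum, hcomp]
    exact schattenSum_comp_le_left hp (norm_sum_rankOne_le_one e.orthonormal e.orthonormal s) _

end Kernels

section SchurMultipliers

variable {p : ℝ}

/-- `φ ↦ Op (k φ)` as a continuous linear map. -/
noncomputable def opMulSymbolL (k : LinftyR2) : L2R2 →L[ℂ] L2R →L[ℂ] L2R :=
  opL ∘L (ContinuousLinearMap.mul ℂ ℂ).holderL volume ∞ 2 2 k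

lemma opMulSymbolL_apply (k : LinftyR2) (φ : L2R2) : opMulSymbolL k φ = Op (mulSymbol k φ) := rfl

lemma schattenNorm_opMulSymbolL_le (hp : 0 < p) (k : LinftyR2) {φ : L2R2}
    (hφ : schattenNorm p (Op φ) ≠ ∞) :
    schattenNorm p (opMulSymbolL k φ) ≤ schurNorm p k * schattenNorm p (Op φ) := by
  rcases eq_or_ne (schattenNorm p (Op φ)) 0 with h0 | h0
  · have hφ0 : φ = 0 := Op_injective <| by
      rw [schattenNorm_eq_zero hp h0, ← opL_apply, map_zero]
    rw [hφ0, map_zero, ← zero_smul ℂ (0 : L2R →L[ℂ] L2R)]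
    exact (schattenNorm_smul_le hp _ _).trans (by simp)
  let c : ℂ := (schattenNorm p (Op φ)).toReal
  have hc : ‖c‖ₑ = schattenNorm p (Op φ) := by
    rw [← ofReal_norm, Complex.norm_real, Real.norm_of_nonneg ENNReal.toReal_nonneg,
      ENNReal.ofReal_toReal hφ]
  have hc0 : c ≠ 0 := by simpa [← hc] using h0
  have hnormalized : schattenNorm p (Op (c⁻¹ • φ)) ≤ 1 := by
    rw [← opL_apply, map_smul]
    refine (schattenNorm_smul_le hp _ _).trans_eq ?_
    rw [enorm_inv hc0, hc, opL_apply, ENNReal.inv_mul_cancel h0 hφ]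
  calc schattenNorm p (opMulSymbolL k φ)
      = schattenNorm p (c • opMulSymbolL k (c⁻¹ • φ)) := by
        rw [← map_smul, smul_inv_smul₀ hc0]
    _ ≤ ‖c‖ₑ * schattenNorm p (opMulSymbolL k (c⁻¹ • φ)) := schattenNorm_smul_le hp _ _
    _ ≤ ‖c‖ₑ * schurNorm p k := by
        gcongr
        exact le_iSup₂_of_le (c⁻¹ • φ) hnormalized le_rfl
    _ = schurNorm p k * schattenNorm p (Op φ) := by rw [hc, mul_comm]

lemma schattenNorm_opMulSymbolL_rankOneKernel_le (hp : 0 < p) (k : LinftyR2) (u v : L2R) :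
    schattenNorm p (opMulSymbolL k (rankOneKernel u v)) ≤ schurNorm p k * (‖u‖ₑ * ‖v‖ₑ) := by
  have hOp : schattenNorm p (Op (rankOneKernel u v)) = ‖u‖ₑ * ‖v‖ₑ := by
    rw [Op_rankOneKernel, schattenNorm_rankOne hp, mul_comm]
  rw [← hOp]
  exact schattenNorm_opMulSymbolL_le hp k
    (hOp.trans_ne (ENNReal.mul_ne_top enorm_ne_top enorm_ne_top))

lemma schattenSum_opMulSymbolL_le_of_finiteDimensional (hp0 : 0 < p) (hp1 : p ≤ 1) {k : LinftyR2}
    {C : ℝ≥0∞}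
    (h : ∀ u v, schattenNorm p (opMulSymbolL k (rankOneKernel u v)) ≤ C * (‖u‖ₑ * ‖v‖ₑ))
    (ψ : L2R2) [FiniteDimensional ℂ (Op ψ).range] :
    schattenSum p (opMulSymbolL k ψ) ≤ C ^ p * schattenSum p (Op ψ) := by
  obtain ⟨m, x, y, hxy, hOp, hsum⟩ := exists_eq_sum_rankOne hp0 (Op ψ)
  have hψ : ψ = ∑ i, rankOneKernel (x i) (y i) := Op_injective <| by
    rw [hOp, ← opL_apply, map_sum]
    simp only [opL_apply, Op_rankOneKernel]
  have hterm (i) : schattenSum p (opMulSymbolL k (rankOneKernel (x i) (y i))) ≤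
      C ^ p * (‖x i‖ₑ ^ 2) ^ p := by
    have hyx : ‖y i‖ₑ = ‖x i‖ₑ := by rw [← ofReal_norm, hxy, ofReal_norm]
    rw [← schattenNorm_rpow hp0.ne', ← ENNReal.mul_rpow_of_nonneg _ _ hp0.le]
    refine ENNReal.rpow_le_rpow ((h (x i) (y i)).trans_eq ?_) hp0.le
    rw [hyx, sq]
  calc schattenSum p (opMulSymbolL k ψ)
      = schattenSum p (∑ i, opMulSymbolL k (rankOneKernel (x i) (y i))) := by rw [hψ, map_sum]
    _ ≤ ∑ i, schattenSum p (opMulSymbolL k (rankOneKernel (x i) (y i))) :=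
        schattenSum_finset_sum_le hp0 hp1 _ _
    _ ≤ ∑ i, C ^ p * (‖x i‖ₑ ^ 2) ^ p := Finset.sum_le_sum fun i _ => hterm i
    _ = C ^ p * schattenSum p (Op ψ) := by rw [hsum, Finset.mul_sum]

lemma schurNorm_le_of_forall_rankOneKernel (hp0 : 0 < p) (hp1 : p ≤ 1) {k : LinftyR2} {C : ℝ≥0∞}
    (h : ∀ u v, schattenNorm p (opMulSymbolL k (rankOneKernel u v)) ≤ C * (‖u‖ₑ * ‖v‖ₑ)) :
    schurNorm p k ≤ C := by
  refine iSup₂_le fun φ hφ => ?_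
  rw [← ENNReal.rpow_le_rpow_iff hp0, schattenNorm_rpow hp0.ne', ← opMulSymbolL_apply]
  have hφ1 : schattenSum p (Op φ) ≤ 1 := by
    rw [← schattenNorm_rpow hp0.ne']
    exact ENNReal.rpow_le_one hφ hp0.le
  refine (isClosed_setOf_schattenSum_le p _).closure_subset <| map_mem_closure
    (opMulSymbolL k).continuous (mem_closure_setOf_finiteDimensional_range_Op hp0.le φ) ?_
  rintro ψ ⟨hψfin, hψ⟩
  calc schattenSum p (opMulSymbolL k ψ) ≤ C ^ p * schattenSum p (Op ψ) :=
        schattenSum_opMulSymbolL_le_of_finiteDimensional hp0 hp1 h ψ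
    _ ≤ C ^ p := mul_le_of_le_one_right' (hψ.trans hφ1)

lemma coeFn_mulSymbol (k : LinftyR2) (φ : L2R2) : mulSymbol k φ =ᵐ[volume] fun z => k z * φ z :=
  ((Lp.memLp φ).mul' (Lp.memLp k)).coeFn_toLp

lemma coeFn_restrictFst {I : Set ℝ} (hI : MeasurableSet I) (k : LinftyR2) :
    restrictFst I hI k =ᵐ[volume] (Prod.fst ⁻¹' I).indicator k :=
  ((Lp.memLp k).indicator (measurable_fst hI)).coeFn_toLp

lemma mulSymbol_restrictFst {I : Set ℝ} (hI : MeasurableSet I) (k : LinftyR2) (φ : L2R2) :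
    mulSymbol (restrictFst I hI k) φ =
      mulSymbol k (indicatorLp (Prod.fst ⁻¹' I) (measurable_fst hI) φ) := by
  refine Lp.ext ?_
  filter_upwards [coeFn_mulSymbol (restrictFst I hI k) φ, coeFn_mulSymbol k (indicatorLp _ _ φ),
    coeFn_restrictFst hI k, coeFn_indicatorLp (measurable_fst hI) φ] with z h₁ h₂ hk hφ
  rw [h₁, h₂, hk, hφ]
  by_cases hz : z ∈ Prod.fst ⁻¹' I <;> simp [hz]

lemma indicatorLp_rankOneKernel {I : Set ℝ} (hI : MeasurableSet I) (u v : L2R) :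
    indicatorLp (Prod.fst ⁻¹' I) (measurable_fst hI) (rankOneKernel u v) =
      rankOneKernel (indicatorLp I hI u) v := by
  refine Lp.ext ?_
  filter_upwards [coeFn_indicatorLp (measurable_fst hI) (rankOneKernel u v),
    coeFn_rankOneKernel u v, coeFn_rankOneKernel (indicatorLp I hI u) v,
    Measure.quasiMeasurePreserving_fst.ae (coeFn_indicatorLp hI u)] with z h₁ h₂ h₃ hu
  rw [h₁, h₃, hu]
  by_cases hz : z.1 ∈ I <;> simp [hz, h₂]

lemma opMulSymbolL_restrictFst_rankOneKernel {I : Set ℝ} (hI : MeasurableSet I) (k : LinftyR2)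
    (u v : L2R) :
    opMulSymbolL (restrictFst I hI k) (rankOneKernel (indicatorLp I hI u) v) =
      opMulSymbolL k (rankOneKernel (indicatorLp I hI u) v) := by
  rw [opMulSymbolL_apply, mulSymbol_restrictFst, indicatorLp_rankOneKernel,
    indicatorLp_indicatorLp_self, opMulSymbolL_apply]

lemma tsum_mul_rpow_le_pFlat {ι : Type*} (hp0 : 0 < p) (hp1 : p ≤ 1) (M a : ι → ℝ≥0∞) :
    (∑' j, (M j * a j) ^ p) ^ (1 / p) ≤
      (∑' j, M j ^ pFlat p) ^ (1 / pFlat p) * (∑' j, a j ^ (2 : ℝ)) ^ (1 / 2 : ℝ) := by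
  let _ : MeasurableSpace ι := ⊤
  have hlt : p < pFlat p := by
    rw [pFlat, lt_div_iff₀ (by linarith)]
    nlinarith
  have hinv : 1 / p = 1 / pFlat p + 1 / 2 := by
    rw [pFlat]
    field_simp
    ring
  simpa [lintegral_count] using
    ENNReal.lintegral_Lp_mul_le_Lq_mul_Lr hp0 hlt hinv Measure.count
      (f := M) (g := a) (Measurable.of_discrete).aemeasurable (Measurable.of_discrete).aemeasurable

variable {ι : Type*} [Countable ι] {I : ι → Set ℝ} (hI : ∀ j, MeasurableSet (I j))

lemma schattenNorm_opMulSymbolL_rankOneKernel_le_tsum (hp0 : 0 < p) (hp1 : p ≤ 1)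
    (hdisj : Pairwise (Disjoint on I)) (hcover : ⋃ j, I j = univ) (k : LinftyR2) (u v : L2R) :
    schattenNorm p (opMulSymbolL k (rankOneKernel u v)) ≤
      (∑' j, schurNorm p (restrictFst (I j) (hI j) k) ^ pFlat p) ^ (1 / pFlat p) *
        (‖u‖ₑ * ‖v‖ₑ) := by
  let M (j : ι) : ℝ≥0∞ := schurNorm p (restrictFst (I j) (hI j) k)
  let w (j : ι) : L2R := indicatorLp (I j) (hI j) u
  have hsum : HasSum (fun j => opMulSymbolL k (rankOneKernel (w j) v))
      (opMulSymbolL k (rankOneKernel u v)) := by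
    simp only [w, ← indicatorLp_rankOneKernel]
    refine (hasSum_indicatorLp (fun j => measurable_fst (hI j))
      (fun i j hij => (hdisj hij).preimage _) ?_ _).mapL (opMulSymbolL k)
    rw [← preimage_iUnion, hcover, preimage_univ]
  have hpiece (j : ι) : schattenSum p (opMulSymbolL k (rankOneKernel (w j) v)) ≤
      (M j * (‖w j‖ₑ * ‖v‖ₑ)) ^ p := by
    rw [← opMulSymbolL_restrictFst_rankOneKernel (hI j), ← schattenNorm_rpow hp0.ne']
    gcongr
    exact schattenNorm_opMulSymbolL_rankOneKernel_le hp0 _ _ _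
  have hnorm : (∑' j, (‖w j‖ₑ * ‖v‖ₑ) ^ (2 : ℝ)) ^ (1 / 2 : ℝ) = ‖u‖ₑ * ‖v‖ₑ := by
    simp only [ENNReal.rpow_two, mul_pow, ENNReal.tsum_mul_right, w,
      tsum_enorm_indicatorLp_sq hI hdisj hcover]
    rw [← mul_pow, ← ENNReal.rpow_two, one_div, ENNReal.rpow_rpow_inv two_ne_zero]
  calc schattenNorm p (opMulSymbolL k (rankOneKernel u v))
      ≤ (∑' j, (M j * (‖w j‖ₑ * ‖v‖ₑ)) ^ p) ^ (1 / p) := by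
        rw [schattenNorm_eq_schattenSum_rpow]
        gcongr
        exact (schattenSum_le_tsum hp0 hp1 hsum).trans (ENNReal.tsum_le_tsum hpiece)
    _ ≤ _ := tsum_mul_rpow_le_pFlat hp0 hp1 M fun j => ‖w j‖ₑ * ‖v‖ₑ
    _ = _ := by rw [hnorm]

end SchurMultipliers

theorem mainTheorem5_general {ι : Type*} [Countable ι] (k : LinftyR2) (p : ℝ) (hp0 : 0 < p)
    (hp1 : p ≤ 1) (I : ι → Set ℝ) (hI : ∀ j, MeasurableSet (I j))
    (hdisj : Pairwise (Disjoint on I)) (hcover : ⋃ j, I j = univ) :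
    schurNorm p k ≤
      (∑' j, schurNorm p (restrictFst (I j) (hI j) k) ^ pFlat p) ^ (1 / pFlat p) :=
  schurNorm_le_of_forall_rankOneKernel hp0 hp1 fun u v =>
    schattenNorm_opMulSymbolL_rankOneKernel_le_tsum hI hp0 hp1 hdisj hcover k u v

theorem mainTheorem5 (k : LinftyR2) (p : ℝ) (hp0 : 0 < p) (hp1 : p ≤ 1)
    (t : ℤ → ℝ)
    (hdisj : Pairwise (Disjoint on fun j : ℤ => Ico (t j) (t (j + 1))))
    (hcover : ⋃ j : ℤ, Ico (t j) (t (j + 1)) = univ) :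
    schurNorm p k ≤
      ellNorm (pFlat p)
        (fun j : ℤ => schurNorm p (restrictFst (Ico (t j) (t (j + 1))) measurableSet_Ico k)) :=
  mainTheorem5_general k p hp0 hp1 _ (fun _ => measurableSet_Ico) hdisj hcover
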